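/- For a linear equation $\mathcal{E}$ in the three variables $x,y,z$ with integer coefficients and an integer $k\ge 1$, the $k$-color Rado number $R_k(\mathcal{E})$ is the smallest $n$ such that every coloring of $\{1,2,\dots,n\}$ with $k$ colors has a monochromatic solution $(x,y,z)$ of $\mathcal{E}$ in $\{1,2,\dots,n\}$ (the entries $x,y,z$ need not be distinct), and $R_k(\mathcal{E})=\infty$ if no such $n$ exists. **Theorem 1.2.** The following equalities hold (so that in particular these Rado numbers are finite). 1. $R_3\bigl(x-y=(m-2)z\bigr)=m^3-m^2-m-1$ for all integers $m\ge 3$. 2. $R_3\bigl(a(x-y)=(a-1)z\bigr)=a^3+(a-1)^2$ for all integers $a\ge 3$. 3. $R_3\bigl(a(x-y)=bz\bigr)=a^3$ for all integers $a,b$ with $b\ge 1$, $a\ge b+2$ and $\gcd(a,b)=1$. -/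

import Mathlib

/-- Every coloring of `[n] = {1, …, n}` with `k` colors has a monochromatic solution to the
three-variable equation `E` (the entries of a solution need not be distinct). -/
def ForcesMonochromaticSolution (k : ℕ) (E : ℤ → ℤ → ℤ → Prop) (n : ℕ) : Prop :=
  ∀ χ : Set.Icc 1 n → Fin k, ∃ x y z : Set.Icc 1 n,
    E (x : ℕ) (y : ℕ) (z : ℕ) ∧ χ x = χ y ∧ χ y = χ z

/-- The `k`-color Rado number `R_k(E)` of an equation `E` in three variables: the smallest `n` such
that every `k`-coloring of `[n]` has a monochromatic solution to `E`, and `⊤` (infinity) if there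
is no such `n`. -/
noncomputable def radoNumber (k : ℕ) (E : ℤ → ℤ → ℤ → Prop) : ℕ∞ :=
  sInf {N : ℕ∞ | ∃ n : ℕ, N = n ∧ ForcesMonochromaticSolution k E n}

/-!
All three equations have the shape `a (x - y) = b z` with `a` and `b` coprime (`a = 1`, `b = m - 2`
in the first one), so the solutions are the triples `z = a t`, `x = y + b t` with `t ≥ 1`.

*Lower bounds.* For part 3, colour `x` by the largest `i ≤ 2` with `a ^ i ∣ x`; below `a ^ 3` a
monochromatic solution would need one more factor `a` in `z` than its colour allows
(`exists_valuation_coloring`). For part 2 the same colouring survives beyond `a ^ 3` once the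
colours of the non-multiples of `a` and of the multiples of `a ^ 2` are interchanged strictly
between `a ^ 2 - a` and `a ^ 3 - a` (`exists_pred_coloring`). For part 1, a good colouring of `[n]`
yields one of `[m n + m - 2]` with one more colour: the new colour is used on a block long enough
to separate two copies of the old colouring, yet too short to contain a solution
(`exists_extend_coloring`).

*Upper bounds.* In each case a few dozen polynomials in the parameters have values in `[n]` for all
admissible values of the parameters, and satisfy enough instances of the equation, as polynomial
identities, that no 3-colouring of these points avoids a monochromatic one. For part 3 this takes
two families of polynomials, one for `a > 2 b` and one for `a < 2 b`; the latter range needs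
polynomials that are not homogeneous in `a` and `b`, since the bound `a ^ 3` fails for `b = a - 1`.
A `Certificate` records the polynomials by their coefficients in variables for which all
coefficients are natural numbers, so that positivity and the comparison with `n` can be read off,
together with the solutions among them and a case distinction on the colours of a few points in
which every case is closed by unit propagation. `Certificate.forces` shows that checking such a
certificate, a finite computation that does not involve the parameters, proves the upper bound.
-/

/-! ### Rado numbers from a forcing length and a colouring -/

/-- The Rado number is `n` if `n` forces a monochromatic solution and some colouring of all natural
numbers has no monochromatic solution with positive entries below `n`. -/
theorem radoNumber_eq {k n : ℕ} {E : ℤ → ℤ → ℤ → Prop} (h : ForcesMonochromaticSolution k E n)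
    (hlt : ∃ χ : ℕ → Fin k, ∀ x y z : ℕ, x < n → y < n → z < n → 0 < x → 0 < y → 0 < z →
      E x y z → χ x = χ y → χ y ≠ χ z) :
    radoNumber k E = (n : ℕ∞) := by
  refine le_antisymm (sInf_le ⟨n, rfl, h⟩) (le_sInf ?_)
  rintro _ ⟨m, rfl, hm⟩
  by_contra! hmn
  have hmn : m < n := by exact_mod_cast hmn
  obtain ⟨χ, hχ⟩ := hlt
  obtain ⟨x, y, z, hE, hxy, hyz⟩ := hm fun i => χ i
  exact hχ x y z (x.2.2.trans_lt hmn) (y.2.2.trans_lt hmn) (z.2.2.trans_lt hmn)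
    x.2.1 y.2.1 z.2.1 hE hxy hyz

/-! ### Colourings without monochromatic solutions -/

/-- A solution is given by `y` and the quotient `t = z / a`. -/
theorem exists_param {a b x y z : ℕ} (ha : 0 < a) (hab : a.Coprime b) (hz : 0 < z)
    (h : (a : ℤ) * (x - y) = (b : ℤ) * z) : ∃ t, 0 < t ∧ z = a * t ∧ x = y + b * t := by
  have h' : a * x = a * y + b * z := by
    zify
    linarith
  obtain ⟨t, rfl⟩ : a ∣ z := hab.dvd_of_dvd_mul_left
    ((Nat.dvd_add_right (Dvd.intro y rfl)).1 (Dvd.intro x h'))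
  refine ⟨t, Nat.pos_of_mul_pos_left hz, rfl, Nat.eq_of_mul_eq_mul_left ha ?_⟩
  rw [h']
  ring

/-- Colouring by the largest `i ≤ 2` with `a ^ i ∣ x` has no monochromatic solution below `a ^ 3`:
if `x`, `y` and `z = a t` are divisible by `a ^ i`, then so is `t`, and `a ^ (i + 1) ∣ z`. -/
theorem exists_valuation_coloring {a b : ℕ} (ha : 0 < a) (hab : a.Coprime b) :
    ∃ χ : ℕ → Fin 3, ∀ x y z : ℕ, x < a ^ 3 → y < a ^ 3 → z < a ^ 3 → 0 < x → 0 < y → 0 < z →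
      (a : ℤ) * (x - y) = (b : ℤ) * z → χ x = χ y → χ y ≠ χ z := by
  classical
  refine ⟨fun x => if a ^ 2 ∣ x then 2 else if a ∣ x then 1 else 0, ?_⟩
  intro x y z _ _ hz _ _ hz0 hE
  obtain ⟨t, ht, rfl, rfl⟩ := exists_param ha hab hz0 hE
  have h1 : a ∣ y + b * t → a ∣ y → a ^ 2 ∣ a * t := by
    intro hx hy
    rw [pow_two]
    exact mul_dvd_mul_left a (hab.dvd_of_dvd_mul_left ((Nat.dvd_add_right hy).1 hx))
  have h2 : a ^ 2 ∣ y + b * t → ¬a ^ 2 ∣ y := by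
    intro hx hy
    have : a * a ^ 2 ∣ a * t :=
      mul_dvd_mul_left a ((hab.pow_left 2).dvd_of_dvd_mul_left ((Nat.dvd_add_right hy).1 hx))
    have := Nat.le_of_dvd hz0 this
    rw [pow_succ'] at hz
    lia
  have h3 : a ∣ a * t := Dvd.intro t rfl
  dsimp only
  split_ifs <;> simp_all

/-- The colouring behind the lower bound for `b = a - 1`. Colour `1` consists of the multiples of
`a` that are not multiples of `a ^ 2`; the other numbers are split between `0` and `2` according to
divisibility by `a ^ 2`, with the two roles interchanged strictly between `a ^ 2 - a` and
`a ^ 3 - a`. -/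
theorem exists_pred_coloring {a : ℕ} (ha : 3 ≤ a) :
    ∃ χ : ℕ → Fin 3, ∀ x y z : ℕ, x < a ^ 3 + (a - 1) ^ 2 → y < a ^ 3 + (a - 1) ^ 2 →
      z < a ^ 3 + (a - 1) ^ 2 → 0 < x → 0 < y → 0 < z →
      (a : ℤ) * (x - y) = ((a - 1 : ℕ) : ℤ) * z → χ x = χ y → χ y ≠ χ z := by
  classical
  obtain ⟨b, rfl⟩ : ∃ b, a = b + 1 := ⟨a - 1, by lia⟩
  rw [Nat.add_sub_cancel]
  have hab : (b + 1).Coprime b := by simp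
  set a := b + 1 with hb
  let χ : ℕ → Fin 3 := fun x => if a ∣ x ∧ ¬a ^ 2 ∣ x then 1 else
    if (a ^ 2 < x + a ∧ x + a < a ^ 3) ↔ a ^ 2 ∣ x then 0 else 2
  have χ_one : ∀ w, χ w = 1 ↔ a ∣ w ∧ ¬a ^ 2 ∣ w := by
    intro w
    dsimp only [χ]
    split_ifs <;> simp_all
  have χ_zero : ∀ w, χ w = 0 ↔
      ¬(a ∣ w ∧ ¬a ^ 2 ∣ w) ∧ ((a ^ 2 < w + a ∧ w + a < a ^ 3) ↔ a ^ 2 ∣ w) := by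
    intro w
    dsimp only [χ]
    split_ifs <;> simp_all
  have χ_two : ∀ w, χ w = 2 ↔
      ¬(a ∣ w ∧ ¬a ^ 2 ∣ w) ∧ ¬((a ^ 2 < w + a ∧ w + a < a ^ 3) ↔ a ^ 2 ∣ w) := by
    intro w
    dsimp only [χ]
    split_ifs <;> simp_all
  clear_value χ
  refine ⟨χ, ?_⟩
  intro x y z hx _ hz _ hy0 hz0 hE hχxy hχyz
  obtain ⟨t, ht, rfl, rfl⟩ := exists_param (by lia) hab hz0 hE
  have haz : a ∣ a * t := Dvd.intro t rfl
  by_cases hat : a ∣ t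
  -- If `a ∤ t`, then `z` has colour `1`, and `a ∣ x - y = b t` is impossible.
  swap
  · have haz2 : ¬a ^ 2 ∣ a * t := by
      rwa [pow_two, Nat.mul_dvd_mul_iff_left (by lia)]
    have hχz := (χ_one _).2 ⟨haz, haz2⟩
    have hy := ((χ_one _).1 (hχyz.trans hχz)).1
    have hx := ((χ_one _).1 (hχxy.trans (hχyz.trans hχz))).1
    exact hat (hab.dvd_of_dvd_mul_left ((Nat.dvd_add_right hy).1 hx))
  obtain ⟨u, rfl⟩ := hat
  have hu : 0 < u := Nat.pos_of_mul_pos_left ht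
  have hz2 : a ^ 2 ∣ a * (a * u) := ⟨u, by ring⟩
  have hxy : a ∣ y + b * (a * u) ↔ a ∣ y :=
    (Nat.dvd_add_iff_left ⟨b * u, by ring⟩).symm
  have hua : u ≤ a := by
    by_contra! h
    have : a * (a * (a + 1)) ≤ a * (a * u) := by gcongr; exact h
    have : b ^ 2 ≤ a ^ 2 := by gcongr; lia
    nlinarith
  have hb2 : b ^ 2 + 2 * a = a ^ 2 + 1 := by rw [hb]; ring
  have ha2 : 3 * a ≤ a ^ 2 := by rw [pow_two]; gcongr
  have ha3 : 3 * a ^ 2 ≤ a ^ 3 := by rw [pow_succ' a 2]; gcongr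
  have hdvd : ¬a ∣ y → y + a ≠ a ^ 3 := fun h h' =>
    h ((Nat.dvd_add_left dvd_rfl).1 (h' ▸ dvd_pow_self a three_ne_zero))
  have sq_dvd : ∀ w, a ^ 2 ∣ w → a ∣ w := fun w => (Dvd.intro_left a (pow_two a).symm).trans
  have hlow : a ^ 2 ≤ b * (a * u) + a := by
    have : b * (a * 1) ≤ b * (a * u) := by gcongr; exact hu
    have : b * (a * 1) + a = a ^ 2 := by rw [hb]; ring
    lia
  have hu1 : a ^ 2 ≤ a * (a * u) := Nat.le_of_dvd hz0 hz2
  have hax := sq_dvd (y + b * (a * u))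
  have hay := sq_dvd y
  rcases hua.lt_or_eq with hua | hua
  -- For `u < a` the number `z = a ^ 2 u` lies in the middle range and has colour `0`.
  · have hzu : a * (a * u) + a ^ 2 ≤ a ^ 3 := by
      have : a * (a * (u + 1)) ≤ a * (a * a) := by gcongr; exact hua
      calc a * (a * u) + a ^ 2 = a * (a * (u + 1)) := by ring
        _ ≤ a * (a * a) := this
        _ = a ^ 3 := by ring
    have hhigh : b * (a * u) + 2 * a ^ 2 ≤ a ^ 3 + a := by
      have : b * (a * u) ≤ b * (a * b) := by gcongr; lia
      have : b * (a * b) + 2 * a ^ 2 = a ^ 3 + a := by rw [hb]; ring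
      lia
    have hsq : a ^ 2 ∣ y → ¬a ^ 2 ∣ y + b * (a * u) := by
      intro hy hx
      have h := (hab.pow_left 2).dvd_of_dvd_mul_left ((Nat.dvd_add_right hy).1 hx)
      rw [pow_two, Nat.mul_dvd_mul_iff_left (by lia)] at h
      exact absurd (Nat.le_of_dvd hu h) (by lia)
    have hχz := (χ_zero (a * (a * u))).2 ⟨fun h => h.2 hz2, by simp only [hz2, iff_true]; lia⟩
    obtain ⟨hy₁, hy₂⟩ := (χ_zero _).1 (hχyz.trans hχz)
    obtain ⟨hx₁, hx₂⟩ := (χ_zero _).1 (hχxy.trans (hχyz.trans hχz))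
    have hay' : ¬a ∣ y := fun h => hsq (by_contra fun h2 => hy₁ ⟨h, h2⟩)
      (by_contra fun h2 => hx₁ ⟨hxy.2 h, h2⟩)
    have hy₃ : ¬(a ^ 2 < y + a ∧ y + a < a ^ 3) :=
      fun h => hay' (hay (hy₂.1 h))
    have hx₃ : ¬(a ^ 2 < y + b * (a * u) + a ∧ y + b * (a * u) + a < a ^ 3) :=
      fun h => hay' (hxy.1 (hax (hx₂.1 h)))
    have := hdvd hay'
    lia
  -- For `u = a` we have `z = a ^ 3`, which has colour `2`.
  · have hzu : a * (a * u) = a ^ 3 := by rw [hua]; ring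
    have hbu : b * (a * u) + a ^ 2 = a ^ 3 := by rw [hua, hb]; ring
    have hχz := (χ_two (a * (a * u))).2 ⟨fun h => h.2 hz2, by simp only [hz2, iff_true]; lia⟩
    obtain ⟨hy₁, hy₂⟩ := (χ_two _).1 (hχyz.trans hχz)
    obtain ⟨hx₁, hx₂⟩ := (χ_two _).1 (hχxy.trans (hχyz.trans hχz))
    by_cases hy : a ^ 2 ∣ y
    · have := Nat.le_of_dvd hy0 hy
      lia
    · have : ¬a ∣ y := fun h => hy₁ ⟨h, hy⟩
      have hx' : ¬a ^ 2 ∣ y + b * (a * u) := fun h => this (hxy.1 (hax h))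
      simp only [hy, hx', iff_false, not_not] at hy₂ hx₂
      lia

/-- A good colouring of `[n]` for the equation `x = y + q z` extends to one of
`[(q + 2) n + q]` with one further colour: use the new colour on `[n + 1, S]`, where
`S = q (n + 1) + n`, and repeat the old colouring on `[S + 1, S + n]`. -/
theorem exists_extend_coloring {q n k : ℕ} (hq : 1 ≤ q) {χ : ℕ → Fin k}
    (hχ : ∀ y z, 0 < y → 0 < z → y + q * z ≤ n → χ (y + q * z) = χ y → χ y ≠ χ z) :
    ∃ χ' : ℕ → Fin (k + 1), ∀ y z, 0 < y → 0 < z → y + q * z ≤ (q + 2) * n + q →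
      χ' (y + q * z) = χ' y → χ' y ≠ χ' z := by
  set S := q * (n + 1) + n with hS
  refine ⟨fun i => if i ≤ n then (χ i).castSucc else if i ≤ S then Fin.last k
    else (χ (i - S)).castSucc, ?_⟩
  intro y z hy hz hle
  have hN : (q + 2) * n + q = S + n := by rw [hS]; ring
  have hlow : z ≤ n → q * z ≤ q * n := Nat.mul_le_mul_left q
  have hmid : n < z → q * (n + 1) ≤ q * z := Nat.mul_le_mul_left q
  have hqz : z ≤ q * z := Nat.le_mul_of_pos_left z hq
  have hqn : q * (n + 1) = q * n + q := by ring
  have old : y + q * z ≤ n → χ (y + q * z) = χ y → χ y ≠ χ z := hχ y z hy hz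
  have high : S < y → χ (y + q * z - S) = χ (y - S) → χ (y - S) ≠ χ z := by
    intro h
    have := hχ (y - S) z (by lia) hz (by lia)
    rwa [← Nat.sub_add_comm h.le] at this
  -- Only for `q = 1` can `z` lie in the last block; then shifting `x` and `z`
  -- back by `S` gives a solution for the old colouring.
  have hzS : S < z → q = 1 := by
    intro h
    by_contra hq1
    have : 2 * z ≤ q * z := Nat.mul_le_mul_right z (by lia)
    lia
  have wrap : S < z → χ (y + q * z - S) = χ y → χ y ≠ χ (z - S) := by
    intro h
    have hq1 := hzS h
    have := hχ y (z - S) hy (by lia) (by rw [hq1] at *; lia)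
    have e : y + q * (z - S) = y + q * z - S := by rw [hq1]; lia
    rwa [e] at this
  have hlast : ∀ i : Fin k, i.castSucc ≠ Fin.last k := fun i => i.castSucc_ne_last
  have hlast' : ∀ i : Fin k, Fin.last k ≠ i.castSucc := fun i => i.castSucc_ne_last.symm
  dsimp only
  split_ifs <;> simp only [hlast, hlast', Fin.castSucc_inj, ne_eq, not_false_eq_true,
    not_true_eq_false, imp_self, implies_true, imp_false, false_imp_iff] <;> lia

/-- Two extensions of the constant colouring of `[q]`. -/
theorem exists_block_coloring {q : ℕ} (hq : 1 ≤ q) :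
    ∃ χ : ℕ → Fin 3, ∀ y z, 0 < y → 0 < z → y + q * z ≤ q ^ 3 + 5 * q ^ 2 + 7 * q →
      χ (y + q * z) = χ y → χ y ≠ χ z := by
  have one : ∀ y z, 0 < y → 0 < z → y + q * z ≤ q →
      (0 : Fin 1) = 0 → (0 : Fin 1) ≠ 0 := by
    intro y z hy hz hle
    have := Nat.le_mul_of_pos_right q hz
    lia
  obtain ⟨χ, hχ⟩ := exists_extend_coloring (χ := fun _ => 0) hq one
  obtain ⟨χ, hχ⟩ := exists_extend_coloring hq hχ
  refine ⟨χ, fun y z hy hz hle => hχ y z hy hz (hle.trans_eq ?_)⟩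
  ring

/-! ### Refuting colourings by cases and unit propagation -/

/-- A refutation by cases of the statement that some colouring `χ : ℕ → Fin 3` of points numbered by
natural numbers has no monochromatic triple in a given list. Every node lists positions in that
list: the triples to be used, in this order, for unit propagation. A `leaf` must then have reached a
contradiction, while `split s v t₀ t₁ t₂` continues with `tᵢ` under the assumption `χ v = i`. -/
inductive CaseTree where
  | leaf (steps : List ℕ) : CaseTree
  | split (steps : List ℕ) (v : ℕ) (t₀ t₁ t₂ : CaseTree) : CaseTree

namespace CaseTree

/-- Unit propagation for one colour. The bits of `e` are points known not to have this colour, the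
bits of `h` are points known to have it. If at most one of `x`, `y`, `z` is missing from `h`, then
the missing point cannot have the colour and is added to `e`; if none is missing, then any of them
may be added, which records the contradiction. -/
def exclude (x y z h e : ℕ) : ℕ :=
  let m := 2 ^ x ||| 2 ^ y ||| 2 ^ z
  let r := m ^^^ (m &&& h)
  bif Nat.beq r 0 || Nat.beq r (2 ^ x) then e ||| 2 ^ x
  else bif Nat.beq r (2 ^ y) then e ||| 2 ^ y
  else bif Nat.beq r (2 ^ z) then e ||| 2 ^ z
  else e

/-- Applies `exclude` for all three colours to the triples of `l` at the given positions and passes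
the resulting bit masks to the continuation `k`. The bits of `eᵢ` are the points known not to have
colour `i`, so those of `e₁ &&& e₂` are known to have colour `0`, and so on. -/
def propagate (l : List (ℕ × ℕ × ℕ)) (k : ℕ → ℕ → ℕ → Bool) : List ℕ → ℕ → ℕ → ℕ → Bool
  | [], e₀, e₁, e₂ => k e₀ e₁ e₂
  | i :: s, e₀, e₁, e₂ =>
    match l[i]? with
    | none => false
    | some (x, y, z) =>
      propagate l k s (exclude x y z (e₁ &&& e₂) e₀) (exclude x y z (e₂ &&& e₀) e₁)
        (exclude x y z (e₀ &&& e₁) e₂)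

/-- Whether the case tree leads to a contradiction, that is, a point excluded from all three
colours, in every case. -/
def refutes (l : List (ℕ × ℕ × ℕ)) : CaseTree → ℕ → ℕ → ℕ → Bool
  | leaf s, e₀, e₁, e₂ => propagate l (fun f₀ f₁ f₂ => !Nat.beq (f₀ &&& f₁ &&& f₂) 0) s e₀ e₁ e₂
  | split s v t₀ t₁ t₂, e₀, e₁, e₂ =>
    propagate l (fun f₀ f₁ f₂ =>
      refutes l t₀ f₀ (f₁ ||| 2 ^ v) (f₂ ||| 2 ^ v) &&
      refutes l t₁ (f₀ ||| 2 ^ v) f₁ (f₂ ||| 2 ^ v) &&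
      refutes l t₂ (f₀ ||| 2 ^ v) (f₁ ||| 2 ^ v) f₂) s e₀ e₁ e₂

/-- No point in the bit mask `e` has colour `c`. -/
def Excludes (χ : ℕ → Fin 3) (c : Fin 3) (e : ℕ) : Prop := ∀ v, e.testBit v = true → χ v ≠ c

theorem Excludes.or_two_pow {χ : ℕ → Fin 3} {c : Fin 3} {e v : ℕ} (he : Excludes χ c e)
    (hv : χ v ≠ c) : Excludes χ c (e ||| 2 ^ v) := by
  intro w hw
  rw [Nat.testBit_or, Nat.testBit_two_pow, Bool.or_eq_true, decide_eq_true_iff] at hw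
  rcases hw with hw | rfl
  exacts [he w hw, hv]

theorem Excludes.exclude {χ : ℕ → Fin 3} {c : Fin 3} {e h x y z : ℕ} (he : Excludes χ c e)
    (hh : ∀ v, h.testBit v = true → χ v = c) (hs : ¬(χ x = χ y ∧ χ y = χ z)) :
    Excludes χ c (exclude x y z h e) := by
  have key : ∀ u, (2 ^ x ||| 2 ^ y ||| 2 ^ z) ^^^ ((2 ^ x ||| 2 ^ y ||| 2 ^ z) &&& h) = u →
      ∀ w, (w = x ∨ w = y ∨ w = z) → u.testBit w = false → χ w = c := by
    rintro u rfl w hw hb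
    apply hh
    have hm : (2 ^ x ||| 2 ^ y ||| 2 ^ z).testBit w = true := by
      simp only [Nat.testBit_or, Nat.testBit_two_pow, Bool.or_eq_true, decide_eq_true_iff]
      tauto
    rw [Nat.testBit_xor, Nat.testBit_and, hm] at hb
    simpa using hb
  have single : ∀ v, v = x ∨ v = y ∨ v = z →
      (2 ^ x ||| 2 ^ y ||| 2 ^ z) ^^^ ((2 ^ x ||| 2 ^ y ||| 2 ^ z) &&& h) = 2 ^ v → χ v ≠ c := by
    intro v hv hu hc
    have all : ∀ w, (w = x ∨ w = y ∨ w = z) → χ w = c := by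
      intro w hw
      by_cases hwv : v = w
      · rw [← hwv, hc]
      · exact key _ hu w hw (by simp [hwv])
    exact hs ⟨(all x (by simp)).trans (all y (by simp)).symm,
      (all y (by simp)).trans (all z (by simp)).symm⟩
  unfold CaseTree.exclude
  simp only [Bool.cond_eq_ite, Bool.or_eq_true, Nat.beq_eq]
  split_ifs with h₁ h₂ h₃
  · refine he.or_two_pow ?_
    rcases h₁ with h₁ | h₁
    · have all := fun w hw => key 0 h₁ w hw (by simp)
      exact absurd ⟨(all x (by simp)).trans (all y (by simp)).symm,
        (all y (by simp)).trans (all z (by simp)).symm⟩ hs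
    · exact single x (by simp) h₁
  · exact he.or_two_pow (single y (by simp) h₂)
  · exact he.or_two_pow (single z (by simp) h₃)
  · exact he

theorem Excludes.eq_of_and {χ : ℕ → Fin 3} {c d d' : Fin 3} {e f : ℕ} (he : Excludes χ d e)
    (hf : Excludes χ d' f) (hc : ∀ i : Fin 3, i ≠ d → i ≠ d' → i = c) (v : ℕ)
    (hv : (e &&& f).testBit v = true) : χ v = c := by
  rw [Nat.testBit_and, Bool.and_eq_true] at hv
  exact hc _ (he v hv.1) (hf v hv.2)

/-- The bit masks `e₀`, `e₁`, `e₂` exclude only colours that are not used by `χ`. -/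
def Sound (χ : ℕ → Fin 3) (e₀ e₁ e₂ : ℕ) : Prop :=
  Excludes χ 0 e₀ ∧ Excludes χ 1 e₁ ∧ Excludes χ 2 e₂

theorem Sound.and_eq_zero {χ : ℕ → Fin 3} {e₀ e₁ e₂ : ℕ} (h : Sound χ e₀ e₁ e₂) :
    e₀ &&& e₁ &&& e₂ = 0 := by
  refine Nat.zero_of_testBit_eq_false fun v => ?_
  by_contra hv
  simp only [Nat.testBit_and, Bool.not_eq_false, Bool.and_eq_true] at hv
  have h₀ := h.1 v hv.1.1
  have h₁ := h.2.1 v hv.1.2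
  have h₂ := h.2.2 v hv.2
  lia

theorem propagate_sound {χ : ℕ → Fin 3} {k : ℕ → ℕ → ℕ → Bool}
    (hk : ∀ f₀ f₁ f₂, Sound χ f₀ f₁ f₂ → k f₀ f₁ f₂ = false) {l : List (ℕ × ℕ × ℕ)}
    (hl : ∀ s ∈ l, ¬(χ s.1 = χ s.2.1 ∧ χ s.2.1 = χ s.2.2)) (s : List ℕ) :
    ∀ e₀ e₁ e₂, Sound χ e₀ e₁ e₂ → propagate l k s e₀ e₁ e₂ = false := by
  induction s with
  | nil => exact hk
  | cons i s ih =>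
    rintro e₀ e₁ e₂ ⟨h₀, h₁, h₂⟩
    rw [propagate]
    cases hi : l[i]? with
    | none => rfl
    | some q =>
      have hq := hl q (List.mem_of_getElem? hi)
      exact ih _ _ _ ⟨h₀.exclude (h₁.eq_of_and h₂ (by decide)) hq,
        h₁.exclude (h₂.eq_of_and h₀ (by decide)) hq, h₂.exclude (h₀.eq_of_and h₁ (by decide)) hq⟩

theorem refutes_sound {χ : ℕ → Fin 3} {l : List (ℕ × ℕ × ℕ)}
    (hl : ∀ s ∈ l, ¬(χ s.1 = χ s.2.1 ∧ χ s.2.1 = χ s.2.2)) (t : CaseTree) :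
    ∀ e₀ e₁ e₂, Sound χ e₀ e₁ e₂ → refutes l t e₀ e₁ e₂ = false := by
  induction t with
  | leaf s =>
    refine propagate_sound (fun f₀ f₁ f₂ h => ?_) hl s
    simp [h.and_eq_zero]
  | split s v t₀ t₁ t₂ ih₀ ih₁ ih₂ =>
    refine propagate_sound (fun f₀ f₁ f₂ ⟨h₀, h₁, h₂⟩ => ?_) hl s
    have hv : χ v = 0 ∨ χ v = 1 ∨ χ v = 2 := by lia
    rcases hv with hv | hv | hv
    · rw [ih₀ _ _ _ ⟨h₀, h₁.or_two_pow (by simp [hv]), h₂.or_two_pow (by simp [hv])⟩]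
      simp
    · rw [ih₁ _ _ _ ⟨h₀.or_two_pow (by simp [hv]), h₁, h₂.or_two_pow (by simp [hv])⟩]
      simp
    · rw [ih₂ _ _ _ ⟨h₀.or_two_pow (by simp [hv]), h₁.or_two_pow (by simp [hv]), h₂⟩]
      simp

/-- By symmetry the case tree may start from `χ 0 = 0` and `χ 1 = 1`, provided that some triple
forces points `0` and `1` to have different colours. The initial masks `2`, `1`, `3` say just this. -/
theorem exists_monochromatic {l : List (ℕ × ℕ × ℕ)} {t : CaseTree}
    (h01 : l.any (fun s => decide (s.1 ≤ 1 ∧ s.2.1 ≤ 1 ∧ s.2.2 ≤ 1)) = true)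
    (ht : refutes l t 2 1 3 = true) (χ : ℕ → Fin 3) :
    ∃ s ∈ l, χ s.1 = χ s.2.1 ∧ χ s.2.1 = χ s.2.2 := by
  by_contra! hl
  have hne : χ 0 ≠ χ 1 := by
    intro h
    obtain ⟨s, hs, hs1⟩ := List.any_eq_true.1 h01
    obtain ⟨hx, hy, hz⟩ := of_decide_eq_true hs1
    have key : ∀ i ≤ 1, χ i = χ 0 := by
      intro i hi
      interval_cases i
      exacts [rfl, h.symm]
    exact hl s hs ((key _ hx).trans (key _ hy).symm) ((key _ hy).trans (key _ hz).symm)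
  obtain ⟨σ, hσ0, hσ1⟩ : ∃ σ : Equiv.Perm (Fin 3), σ (χ 0) = 0 ∧ σ (χ 1) = 1 := by
    generalize χ 0 = i at hne
    generalize χ 1 = j at hne
    revert i j
    decide
  have hz : ∀ c, Excludes (fun v => σ (χ v)) c 0 := fun c v hv => by simp at hv
  have s0 : Excludes (fun v => σ (χ v)) 0 2 := by
    simpa using (hz 0).or_two_pow (v := 1) (by simp [hσ1])
  have s1 : Excludes (fun v => σ (χ v)) 1 1 := by
    simpa using (hz 1).or_two_pow (v := 0) (by simp [hσ0])
  have s2 : Excludes (fun v => σ (χ v)) 2 3 := by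
    simpa using ((hz 2).or_two_pow (v := 0) (by simp [hσ0])).or_two_pow (v := 1) (by simp [hσ1])
  have := refutes_sound (χ := fun v => σ (χ v)) (l := l) (by simpa using hl) t 2 1 3 ⟨s0, s1, s2⟩
  simp [ht] at this

end CaseTree

/-! ### Polynomials as coefficient lists -/

namespace CoeffList

/-- The value of the polynomial with coefficients `p` where the monomials have the values `μ`. -/
def eval (μ p : List ℕ) : ℕ := (List.zipWith (· * ·) p μ).sum

/-- Addition of coefficient lists; the shorter one is padded with zeros. -/
def add : List ℕ → List ℕ → List ℕ
  | [], q => q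
  | p, [] => p
  | x :: p, y :: q => (x + y) :: add p q

/-- The linear combination of the rows of `A` with coefficients `t`. -/
def combine : List ℕ → List (List ℕ) → List ℕ
  | k :: t, r :: A => add (r.map (k * ·)) (combine t A)
  | _, _ => []

/-- Coefficientwise comparison. -/
def le : List ℕ → List ℕ → Bool
  | [], _ => true
  | x :: p, y :: q => Nat.ble x y && le p q
  | _ :: _, [] => false

theorem eval_cons_cons (m x : ℕ) (μ p : List ℕ) : eval (m :: μ) (x :: p) = x * m + eval μ p := by
  simp [eval]

theorem eval_nil (μ : List ℕ) : eval μ [] = 0 := by simp [eval]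

theorem eval_nil_left (p : List ℕ) : eval [] p = 0 := by simp [eval]

theorem eval_add (μ p q : List ℕ) : eval μ (add p q) = eval μ p + eval μ q := by
  induction μ generalizing p q with
  | nil => simp [eval_nil_left]
  | cons m μ ih =>
    rcases p with _ | ⟨x, p⟩
    · simp [add, eval_nil]
    rcases q with _ | ⟨y, q⟩
    · simp [add, eval_nil]
    simp only [add, eval_cons_cons, ih]
    ring

theorem eval_map_mul (μ p : List ℕ) (k : ℕ) : eval μ (p.map (k * ·)) = k * eval μ p := by
  induction μ generalizing p with
  | nil => simp [eval_nil_left]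
  | cons m μ ih =>
    rcases p with _ | ⟨x, p⟩
    · simp [eval_nil]
    simp only [List.map_cons, eval_cons_cons, ih]
    ring

/-- If the rows of `A` are the products of `a` with the monomials of values `ν`, then `combine t A`
is the product of `a` with the polynomial `t`. -/
theorem eval_combine {μ ν : List ℕ} {A : List (List ℕ)} {a : ℕ}
    (h : A.map (eval μ) = ν.map (a * ·)) (t : List ℕ) :
    eval μ (combine t A) = a * eval ν t := by
  induction t generalizing A ν with
  | nil => simp [combine, eval_nil]
  | cons k t ih =>
    rcases A with _ | ⟨r, A⟩ <;> rcases ν with _ | ⟨m, ν⟩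
    · simp [combine, eval_nil, eval_nil_left]
    · simp at h
    · simp at h
    simp only [List.map_cons, List.cons.injEq] at h
    simp only [combine, eval_add, eval_map_mul, eval_cons_cons, h.1, ih h.2]
    ring

theorem eval_mono {p q : List ℕ} (h : le p q = true) (μ : List ℕ) : eval μ p ≤ eval μ q := by
  induction μ generalizing p q with
  | nil => simp [eval_nil_left]
  | cons m μ ih =>
    rcases p with _ | ⟨x, p⟩
    · simp [eval_nil]
    rcases q with _ | ⟨y, q⟩
    · simp [le] at h
    simp only [le, Bool.and_eq_true, Nat.ble_eq] at h
    simp only [eval_cons_cons]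
    exact Nat.add_le_add (Nat.mul_le_mul_right _ h.1) (ih h.2)

theorem eval_mono_left {κ μ : List ℕ} (h : List.Forall₂ (· ≤ ·) κ μ) (p : List ℕ) :
    eval κ p ≤ eval μ p := by
  induction h generalizing p with
  | nil => exact le_rfl
  | cons hm _ ih =>
    rcases p with _ | ⟨x, p⟩
    · simp [eval_nil]
    simp only [eval_cons_cons]
    exact Nat.add_le_add (Nat.mul_le_mul_left _ hm) (ih p)

end CoeffList

/-! ### Certificates for upper bounds -/

/-- A proof that `[n]` forces a monochromatic solution of `a (x - y) = b z`, where `a`, `b` and `n`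
are polynomials in some parameters. Polynomials are given by their coefficients with respect to a
list of monomials of degree at most 3, or at most 2 for the quotients `t = z / a`.
* `size` is the polynomial `n`;
* `lower` is a lower bound for the values of the monomials;
* the rows of `mulA` and `mulB` are the products of `a` and `b` with the monomials of degree at
  most 2;
* `points` are the points to be coloured;
* an entry `(z, t, l)` of `solutions` says that point number `z` is `a t`, and that point number `x`
  is `b t` plus point number `y`, for all `(x, y)` in `l`;
* `cases` shows that all 3-colourings of the points make one of these solutions monochromatic. -/
structure Certificate where
  size : List ℕ
  lower : List ℕ
  mulA : List (List ℕ)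
  mulB : List (List ℕ)
  points : List (List ℕ)
  solutions : List (ℕ × List ℕ × List (ℕ × ℕ))
  cases : CaseTree

namespace Certificate

open CoeffList

/-- The solutions `(x, y, z)`, as numbers of points. -/
def triples (C : Certificate) : List (ℕ × ℕ × ℕ) :=
  C.solutions.flatMap fun s => s.2.2.map fun q => (q.1, q.2, s.1)

/-- All points lie between `1` and `n`. -/
def pointsInRange (C : Certificate) : Bool :=
  C.points.all fun p => le p C.size && Nat.ble 1 (eval C.lower p)

/-- The listed solutions satisfy `z = a t` and `x = y + b t`. -/
def solutionsCorrect (C : Certificate) : Bool :=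
  C.solutions.all fun s =>
    decide (C.points[s.1]? = some (combine s.2.1 C.mulA)) && s.2.2.all fun q =>
      decide (q.2 < C.points.length ∧
        C.points[q.1]? = some (add (C.points.getD q.2 []) (combine s.2.1 C.mulB)))

/-- The computation that checks a certificate. -/
def valid (C : Certificate) : Bool :=
  C.pointsInRange && C.solutionsCorrect &&
    C.triples.any (fun s => decide (s.1 ≤ 1 ∧ s.2.1 ≤ 1 ∧ s.2.2 ≤ 1)) &&
    C.cases.refutes C.triples 2 1 3

/-- A valid certificate proves its upper bound for all values `μ` of the monomials of degree at most
3 that are bounded below by `lower`; `ν` are the values of the monomials of degree at most 2. -/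
theorem forces {C : Certificate} (hC : C.valid = true) {a b n : ℕ} (μ ν : List ℕ)
    (hμ : List.Forall₂ (· ≤ ·) C.lower μ) (hA : C.mulA.map (eval μ) = ν.map (a * ·))
    (hB : C.mulB.map (eval μ) = ν.map (b * ·)) (hn : eval μ C.size = n) :
    ForcesMonochromaticSolution 3 (fun x y z => (a : ℤ) * (x - y) = (b : ℤ) * z) n := by
  simp only [valid, Bool.and_eq_true] at hC
  obtain ⟨⟨⟨hrange, hsol⟩, h01⟩, href⟩ := hC
  intro χ
  have mem : ∀ p ∈ C.points, eval μ p ∈ Set.Icc 1 n := by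
    intro p hp
    have := List.all_eq_true.1 hrange p hp
    simp only [Bool.and_eq_true, Nat.ble_eq] at this
    exact ⟨this.2.trans (eval_mono_left hμ p), hn ▸ eval_mono this.1 μ⟩
  obtain ⟨⟨x, y, z⟩, hs, hxy, hyz⟩ := CaseTree.exists_monochromatic h01 href fun i =>
    if h : eval μ (C.points.getD i []) ∈ Set.Icc 1 n then χ ⟨_, h⟩ else 0
  simp only [triples, List.mem_flatMap, List.mem_map, Prod.mk.injEq] at hs
  obtain ⟨⟨z, t, l⟩, hs, ⟨x, y⟩, hq, rfl, rfl, rfl⟩ := hs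
  have hs := List.all_eq_true.1 hsol _ hs
  simp only [Bool.and_eq_true, decide_eq_true_eq, List.all_eq_true] at hs
  obtain ⟨hz, hs⟩ := hs
  obtain ⟨hy, hx⟩ := hs _ hq
  dsimp only at hx hy hz hxy hyz
  obtain ⟨q, hyq⟩ : ∃ q, C.points[y]? = some q := ⟨_, List.getElem?_eq_getElem hy⟩
  rw [List.getD_eq_getElem?_getD, hyq, Option.getD_some] at hx
  simp only [List.getD_eq_getElem?_getD, hx, hyq, hz, Option.getD_some] at hxy hyz
  have mx := mem _ (List.mem_of_getElem? hx)
  have my := mem _ (List.mem_of_getElem? hyq)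
  have mz := mem _ (List.mem_of_getElem? hz)
  rw [dif_pos mx, dif_pos my] at hxy
  rw [dif_pos my, dif_pos mz] at hyz
  refine ⟨⟨_, mx⟩, ⟨_, my⟩, ⟨_, mz⟩, ?_, hxy, hyz⟩
  simp only [eval_add, eval_combine hA, eval_combine hB]
  push_cast
  ring

end Certificate

/-! ### The four certificates -/

/-- Certificate for `a = 1`, `b = m - 2` and `n = m ^ 3 - m ^ 2 - m - 1`, in powers of
`u = m - 3`. -/
def Certificate.schur : Certificate where
  size := [14, 20, 8, 1]
  lower := [1, 0, 0, 0]
  mulA := [[1, 0, 0, 0], [0, 1, 0, 0], [0, 0, 1, 0]]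
  mulB := [[1, 1, 0, 0], [0, 1, 1, 0], [0, 0, 1, 1]]
  points := [
    [1, 0, 0, 0], [2, 1, 0, 0], [2, 0, 0, 0], [1, 1, 0, 0], [3, 1, 0, 0], [4, 1, 0, 0],
    [3, 2, 0, 0], [4, 2, 0, 0], [5, 2, 0, 0], [4, 3, 0, 0], [3, 3, 1, 0], [2, 4, 1, 0],
    [3, 4, 1, 0], [4, 4, 1, 0], [5, 4, 1, 0], [4, 5, 1, 0], [5, 5, 1, 0], [6, 5, 1, 0],
    [7, 5, 1, 0], [6, 6, 1, 0], [7, 6, 1, 0], [8, 6, 1, 0], [9, 6, 1, 0], [6, 7, 2, 0],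
    [7, 8, 2, 0], [8, 9, 2, 0], [3, 6, 5, 1], [4, 7, 5, 1], [5, 8, 5, 1], [6, 10, 6, 1],
    [7, 11, 6, 1], [8, 12, 6, 1], [9, 13, 6, 1], [10, 14, 6, 1], [9, 14, 7, 1], [10, 15, 7, 1],
    [11, 16, 7, 1], [12, 17, 7, 1], [11, 17, 8, 1], [12, 18, 8, 1], [13, 19, 8, 1],
    [14, 20, 8, 1]]
  solutions := [
    (0, [1, 0, 0], [(1, 0), (4, 2), (7, 4), (9, 6), (13, 10), (15, 12), (16, 13), (17, 14),
    (19, 16), (20, 17), (21, 18), (24, 23), (25, 24), (31, 30), (32, 31), (35, 34), (36, 35),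
    (37, 36), (39, 38), (40, 39), (41, 40)]), (1, [2, 1, 0], [(12, 3), (13, 1), (14, 4), (17, 7),
    (24, 16), (25, 19), (29, 27), (30, 28), (34, 30), (35, 31), (36, 32), (37, 33), (38, 34),
    (39, 35), (40, 36)]), (2, [2, 0, 0], [(6, 0), (7, 2), (9, 1), (16, 10), (28, 26), (31, 29),
    (32, 30), (36, 34), (37, 35)]), (3, [1, 1, 0], [(13, 6), (23, 16), (24, 19), (34, 31),
    (35, 32), (36, 33), (38, 35), (39, 36)]), (4, [3, 1, 0], [(13, 0), (15, 3), (16, 1), (17, 4),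
    (18, 5), (19, 6), (20, 7), (21, 8), (23, 10), (24, 13), (25, 16), (29, 26), (30, 27),
    (31, 28), (34, 29), (35, 30), (36, 31), (37, 32), (39, 34), (40, 35), (41, 36)]), (5, [4, 1,
    0], [(16, 0), (17, 2), (19, 1), (20, 4), (21, 5), (24, 10), (25, 13), (35, 29), (36, 30),
    (40, 34), (41, 35)]), (6, [3, 2, 0], [(23, 6), (24, 9), (39, 32)]), (7, [4, 2, 0], [(39, 31),
    (40, 32)]), (8, [5, 2, 0], [(23, 0), (24, 1), (39, 30)]), (10, [3, 3, 1], [(33, 24)]), (11,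
    [2, 4, 1], [(26, 0), (27, 1), (29, 13), (30, 16), (35, 25)]), (12, [3, 4, 1], [(27, 0),
    (28, 1), (30, 13), (31, 16), (32, 19), (35, 24)]), (13, [4, 4, 1], [(28, 0), (30, 10),
    (31, 13), (32, 16), (33, 19), (35, 23), (36, 24)]), (14, [5, 4, 1], [(31, 10), (32, 13),
    (33, 16)]), (15, [4, 5, 1], [(29, 1), (31, 9), (34, 16), (35, 19)]), (16, [5, 5, 1],
    [(29, 0), (30, 1), (31, 6), (32, 9), (34, 13), (35, 16), (36, 19), (39, 24), (40, 25)]), (17,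
    [6, 5, 1], [(30, 0), (31, 1), (32, 6), (35, 13), (36, 16), (39, 23), (40, 24), (41, 25)]),
    (18, [7, 5, 1], [(31, 0), (32, 1), (33, 6), (36, 13), (37, 16), (40, 23)]), (19, [6, 6, 1],
    [(34, 6), (35, 9), (38, 16), (39, 19)]), (20, [7, 6, 1], [(34, 1), (35, 6), (36, 9),
    (38, 13), (39, 16)]), (21, [8, 6, 1], [(34, 0), (35, 1), (36, 6), (39, 13), (40, 16),
    (41, 19)]), (22, [9, 6, 1], [(35, 0), (36, 1), (40, 13), (41, 16)])]
  cases :=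
    .split [22] 13 (.split [6, 107, 53, 4, 105] 35 (.split [16, 131, 110, 157, 15] 4 (.leaf [])
    (.split [56, 55, 132, 69, 35, 73, 121, 158, 160, 20, 84, 155] 5 (.leaf []) (.leaf [78, 77,
    57, 154, 10, 141, 85, 147, 150, 45, 71, 52, 48]) (.leaf [75, 83, 43, 36, 153, 142, 71, 156,
    154, 145])) (.leaf [56, 24, 129, 69, 66, 35, 31, 28, 100, 132, 158, 63, 160, 102, 101, 99,
    65, 97, 27, 95, 96, 67, 146, 33, 43, 41, 37, 98, 135, 20, 59, 89, 103, 26, 149, 144]))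
    (.split [30, 124, 34, 152, 121, 102] 39 (.leaf [19, 145, 18, 154, 155, 35, 72, 66, 69, 28,
    100, 101, 97, 65, 99, 27, 95, 96, 94, 64, 67, 40, 41, 36, 43, 33, 144, 142]) (.leaf [])
    (.split [150, 126, 88] 4 (.leaf []) (.split [56, 68, 23] 23 (.leaf [90, 11, 104, 101, 91,
    92]) (.leaf [85, 36, 61, 3, 112, 39, 113, 44, 38, 7, 132, 122, 31, 139, 137, 17, 140]) (.leaf
    [46, 133, 9, 59, 37, 128, 147, 45, 49, 130, 122, 3, 42, 38])) (.leaf [56, 66, 28, 100, 101,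
    99, 97, 65, 27, 95, 96, 64, 41, 94, 40, 37, 36, 147, 24, 9]))) (.leaf [124, 55, 120, 56, 68,
    25, 101, 128, 132, 129, 69, 66, 111, 100, 104])) (.leaf []) (.split [107] 35 (.split [15,
    157, 124, 16] 30 (.leaf [13, 68, 128, 129, 56, 55, 69, 132]) (.leaf [29, 123, 120]) (.split
    [106, 101] 36 (.leaf []) (.split [35, 31, 158, 159, 19, 72] 31 (.leaf [14, 108, 132, 25, 55,
    62, 56, 134]) (.leaf [69, 56, 129, 134, 62, 25, 9, 108, 123, 146, 59, 150, 89, 88]) (.leaf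
    [])) (.split [139, 111, 82] 16 (.leaf []) (.split [55, 25, 104, 102, 136, 21, 14, 140, 137,
    42, 113] 2 (.leaf [44, 1, 70]) (.leaf [39, 79, 76, 112, 93, 114, 109, 47, 50]) (.leaf []))
    (.split [108, 125, 132, 123, 146, 33] 18 (.leaf [136, 129, 9, 56, 48, 150, 148, 149, 18, 71,
    51, 54, 145, 118, 143, 116]) (.leaf [137, 49, 14, 48, 129, 45, 130, 46, 9, 142, 143, 85, 148,
    86, 11]) (.leaf []))))) (.split [34, 152, 124, 30, 136, 14, 13] 32 (.leaf []) (.split [49,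
    137, 31, 139, 17, 69] 6 (.leaf [121, 36, 140, 153, 44, 154, 37, 19, 155, 88, 89]) (.split
    [130, 147, 85] 17 (.leaf [132, 9, 150, 133, 52, 46]) (.leaf []) (.leaf [56, 70, 140, 102,
    125, 68, 101, 104, 58, 145, 126, 52, 47])) (.leaf [138, 45, 52, 50, 32, 145, 154, 78, 140,
    102, 125, 76, 103, 57, 68, 101])) (.split [108, 8, 102, 121, 113, 74] 19 (.leaf []) (.split
    [26, 76, 80, 127, 78, 63, 151, 12] 24 (.leaf []) (.leaf [104, 101, 68, 57, 56, 29, 77, 83,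
    134, 141, 71, 133, 85, 9, 147]) (.leaf [62, 58, 130, 56, 23, 7])) (.leaf [145, 19, 103, 126,
    21, 88, 104, 47, 52, 62, 111, 35, 134, 89, 24, 56, 23, 7]))) (.split [124, 131, 110] 16
    (.split [119, 8, 74] 4 (.leaf [2, 56, 129, 1, 63, 24, 37, 38, 75, 80, 81, 115, 26, 143, 116,
    118]) (.split [23, 56, 128, 9, 132, 7, 113] 6 (.leaf [130, 137, 36, 121, 69, 70, 3, 139, 140,
    44, 38, 42, 148, 82, 77]) (.leaf [85, 58, 145, 133, 87, 14, 11, 143, 122, 69, 86, 111])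
    (.split [45, 147, 146, 77, 78, 81, 115, 80, 84] 34 (.leaf [117, 118, 151, 26, 135, 156])
    (.leaf []) (.leaf [83, 142, 26, 135, 73, 12, 127, 111, 139, 156, 10, 47, 141, 46]))) (.split
    [68, 62, 72] 19 (.leaf []) (.leaf [145, 76, 26, 80, 78, 127, 12, 57, 84, 134, 128, 135, 29,
    156, 10, 151, 71, 133, 141]) (.split [118, 145, 143, 58] 31 (.leaf [121, 13, 85, 90, 11, 29,
    86, 91, 116, 60, 115, 81, 67, 151, 78]) (.split [129, 128, 132, 29, 9] 6 (.leaf [3, 36, 116,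
    38, 117, 43, 82, 148, 77]) (.leaf [85, 90, 133, 11, 86, 87, 122, 92, 103, 49, 46, 21, 60, 5,
    115, 81, 78, 67, 151]) (.leaf [])) (.leaf [])))) (.split [120, 55, 25] 17 (.leaf [56, 128,
    68]) (.leaf [132, 129, 24, 13, 68, 2, 37, 106, 69, 1, 39, 75, 111, 82, 79]) (.leaf []))
    (.leaf [])))

/-- Certificate for `b = a - 1` and `n = a ^ 3 + (a - 1) ^ 2`, in powers of `u = a - 3`. -/
def Certificate.pred : Certificate where
  size := [31, 31, 10, 1]
  lower := [1, 0, 0, 0]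
  mulA := [[3, 1, 0, 0], [0, 3, 1, 0], [0, 0, 3, 1]]
  mulB := [[2, 1, 0, 0], [0, 2, 1, 0], [0, 0, 2, 1]]
  points := [
    [27, 27, 9, 1], [9, 6, 1, 0], [1, 0, 0, 0], [2, 1, 0, 0], [3, 1, 0, 0], [5, 2, 0, 0],
    [3, 4, 1, 0], [5, 4, 1, 0], [6, 5, 1, 0], [7, 5, 1, 0], [8, 6, 1, 0], [11, 7, 1, 0],
    [12, 7, 1, 0], [11, 9, 2, 0], [12, 10, 2, 0], [13, 10, 2, 0], [15, 11, 2, 0], [17, 12, 2, 0],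
    [18, 12, 2, 0], [19, 15, 3, 0], [9, 15, 7, 1], [12, 16, 7, 1], [15, 17, 7, 1],
    [17, 18, 7, 1], [15, 20, 8, 1], [18, 21, 8, 1], [19, 21, 8, 1], [20, 22, 8, 1],
    [21, 22, 8, 1], [23, 23, 8, 1], [24, 23, 8, 1], [24, 26, 9, 1], [25, 26, 9, 1],
    [29, 28, 9, 1], [30, 28, 9, 1], [31, 31, 10, 1]]
  solutions := [
    (0, [9, 6, 1], [(0, 1), (26, 2), (27, 3), (28, 4), (29, 5), (31, 8), (32, 9), (34, 12),
    (35, 15)]), (1, [3, 1, 0], [(1, 4), (9, 2), (10, 3), (11, 5), (13, 7), (14, 8), (15, 9),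
    (16, 1), (17, 11), (18, 12), (19, 15), (25, 21), (28, 22), (29, 23), (31, 25), (32, 26),
    (33, 29), (34, 30), (35, 32)]), (4, [1, 0, 0], [(0, 32), (4, 2), (5, 4), (9, 7), (10, 8),
    (15, 13), (17, 16), (23, 22), (27, 25), (28, 26), (29, 28), (33, 0)]), (6, [1, 1, 0],
    [(15, 11), (32, 29), (35, 33)]), (8, [2, 1, 0], [(0, 29), (1, 5), (8, 3), (9, 4), (15, 1),
    (16, 11), (19, 16), (26, 22), (28, 23), (32, 28)]), (12, [4, 1, 0], [(1, 2), (16, 9),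
    (19, 13), (33, 28)]), (14, [4, 2, 0], [(15, 5), (32, 23)]), (16, [5, 2, 0], [(0, 23),
    (14, 3), (15, 4), (16, 5), (32, 22), (35, 28)]), (18, [6, 2, 0], [(0, 22), (15, 2), (16, 4),
    (17, 5), (19, 9), (31, 21), (33, 23), (35, 26)]), (20, [3, 4, 1], [(21, 8), (22, 1),
    (23, 11), (26, 15), (28, 16), (30, 18)]), (21, [4, 4, 1], [(0, 19), (22, 9), (23, 1),
    (26, 13), (28, 15), (29, 16)]), (22, [5, 4, 1], [(22, 7), (23, 9), (28, 13), (29, 15)]), (24,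
    [5, 5, 1], [(0, 17), (22, 5), (26, 1), (28, 11), (32, 16)]), (25, [6, 5, 1], [(0, 16),
    (22, 4), (23, 5), (25, 8), (26, 9), (28, 1), (29, 11), (32, 15), (33, 17), (34, 18)]), (28,
    [7, 5, 1], [(0, 15), (22, 2), (23, 4), (26, 7), (27, 8), (28, 9), (29, 1), (32, 13),
    (33, 16)]), (30, [8, 5, 1], [(0, 13), (23, 2), (28, 7), (29, 9)]), (31, [8, 6, 1], [(0, 11),
    (25, 3), (26, 4), (28, 5), (31, 10), (32, 1), (35, 16)]), (34, [10, 6, 1], [(0, 9), (28, 2),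
    (29, 4)])]
  cases :=
    .split [9, 16] 4 (.split [3, 39, 30, 28, 29] 28 (.leaf []) (.split [21, 110, 99] 8 (.split
    [43, 32, 97, 5, 45, 100] 11 (.leaf [48, 62, 120, 118, 11, 121]) (.leaf [17, 12, 96, 62, 59,
    67, 34, 68, 71, 102]) (.leaf [])) (.leaf [51, 44, 62, 94, 59, 96]) (.leaf [97, 95, 94, 49,
    62, 48, 120, 63, 27, 12, 117, 100, 123, 88, 84, 8, 83, 79, 19])) (.split [109] 15 (.leaf [61,
    77, 64, 112, 62, 33, 25, 12, 8, 44, 27, 42, 52, 46, 97, 111, 10, 105, 43, 13, 84, 41, 40,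
    100, 20, 98, 73, 74, 50, 107, 85]) (.leaf [47, 15, 46, 31, 52, 101, 97, 24, 95, 98, 50, 85,
    107]) (.split [83] 25 (.leaf [95, 97, 94, 62, 77, 12, 44, 48, 112, 25, 52, 100, 88, 51, 85,
    24, 74, 75, 86, 31, 107, 98]) (.split [20, 23, 97, 79] 22 (.leaf [80, 98, 10, 85, 65, 35,
    125, 66, 69, 103, 18, 7, 56, 55, 71, 51, 50, 76, 114, 73, 107, 13, 78, 113]) (.split [74, 85]
    23 (.leaf [59, 77, 62, 75, 73, 12, 48]) (.leaf [96, 120, 86, 31, 46, 119, 107, 24, 52])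
    (.leaf [51, 5, 120, 12, 73, 77, 75, 48])) (.leaf [105, 87, 85, 10, 46, 50, 31, 52, 24, 82,
    13])) (.split [97, 101, 122] 31 (.leaf [5, 117, 44, 96, 62, 34, 59, 81, 67, 22, 84, 100, 17,
    68, 102, 71]) (.leaf []) (.leaf [120, 121, 118, 44, 45, 32, 11]))))) (.leaf []) (.split [30,
    29] 16 (.split [94, 59, 62, 44, 12] 25 (.leaf []) (.split [96, 35, 23, 106, 99, 77, 109, 104]
    26 (.leaf [1, 10, 46, 48, 50, 74, 75]) (.leaf [98, 46, 31, 48, 75, 76, 74, 85, 33, 87, 13])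
    (.leaf [119, 117, 5, 75, 74, 46, 105, 10])) (.leaf [97, 95, 48, 43, 100, 22, 110, 75, 106,
    104, 109, 52, 77, 74, 105, 50, 10, 98, 24, 76, 101])) (.leaf []) (.split [67, 61, 34] 9
    (.split [109, 6, 124] 29 (.leaf [4, 43, 44, 12, 48, 100, 97, 99, 64, 52, 27, 101, 8]) (.split
    [25, 110, 22, 77, 106, 64, 112, 37, 86, 71] 22 (.leaf []) (.leaf [74, 88, 8, 76, 72]) (.leaf
    [63, 27, 95, 8, 24, 101, 98])) (.split [126, 84, 38, 99, 125, 21, 1] 32 (.leaf []) (.leaf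
    [122, 52, 24, 119, 121, 5, 45, 32, 97, 11, 118]) (.split [63, 93, 86, 80, 65, 70, 83, 81, 58]
    17 (.leaf [89, 91, 119, 5, 92, 117, 48, 14, 44, 57]) (.leaf [68, 57, 14, 17, 90, 91, 119, 5,
    48, 117]) (.leaf [])))) (.leaf [15, 8, 10, 1, 109, 66, 104, 37, 72, 64]) (.split [54, 109,
    46, 31] 8 (.split [43, 97] 28 (.split [52, 104] 22 (.leaf [105, 65, 66]) (.leaf [88, 85, 126,
    115, 116, 26, 7, 53, 125]) (.leaf [95, 63, 101])) (.leaf [99, 21, 95, 50, 85, 98, 107])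
    (.leaf [])) (.leaf [44, 45, 14, 47, 97, 57, 104, 108, 60, 2, 52, 51, 36, 96, 101, 58]) (.leaf
    []))))

/-- Certificate for `n = a ^ 3` and `a > 2 b`, homogeneous in `b` and `d = a - 2 b`. -/
def Certificate.largeRatio : Certificate where
  size := [8, 12, 6, 1]
  lower := [1, 1, 1, 1]
  mulA := [[2, 1, 0, 0], [0, 2, 1, 0], [0, 0, 2, 1]]
  mulB := [[1, 0, 0, 0], [0, 1, 0, 0], [0, 0, 1, 0]]
  points := [
    [8, 12, 6, 1], [4, 8, 5, 1], [2, 1, 0, 0], [0, 2, 1, 0], [1, 2, 1, 0], [2, 3, 1, 0],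
    [3, 4, 1, 0], [4, 4, 1, 0], [6, 5, 1, 0], [4, 6, 2, 0], [5, 6, 2, 0], [6, 7, 2, 0],
    [8, 8, 2, 0], [0, 2, 3, 1], [0, 4, 4, 1], [1, 4, 4, 1], [1, 5, 4, 1], [2, 5, 4, 1],
    [3, 5, 4, 1], [3, 6, 4, 1], [4, 6, 4, 1], [5, 7, 4, 1], [1, 6, 5, 1], [2, 7, 5, 1],
    [3, 7, 5, 1], [3, 8, 5, 1], [5, 8, 5, 1], [5, 9, 5, 1], [6, 9, 5, 1], [7, 9, 5, 1],
    [7, 10, 5, 1], [8, 10, 5, 1], [3, 9, 6, 1], [3, 10, 6, 1], [4, 10, 6, 1], [5, 10, 6, 1],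
    [6, 11, 6, 1], [7, 11, 6, 1]]
  solutions := [
    (0, [4, 4, 1], [(0, 1), (10, 4), (11, 5), (20, 13), (26, 15), (28, 17), (29, 18), (30, 19),
    (31, 20), (35, 22), (36, 23), (37, 24)]), (1, [2, 3, 1], [(1, 17), (7, 2), (9, 5), (11, 7),
    (23, 14), (24, 15), (27, 19), (28, 20), (30, 21), (35, 24), (36, 1), (37, 26)]), (2, [1, 0,
    0], [(1, 25), (17, 16), (20, 19), (26, 1), (28, 27), (29, 28), (31, 30), (37, 36)]), (3, [0,
    1, 0], [(19, 18), (25, 24), (33, 32)]), (5, [1, 1, 0], [(0, 37), (1, 24), (5, 4), (6, 5),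
    (16, 14), (17, 15), (19, 17), (20, 18), (21, 20), (23, 22), (25, 23), (27, 1), (28, 26),
    (30, 28), (36, 35)]), (7, [2, 1, 0], [(0, 36), (1, 23), (7, 5), (8, 7), (17, 14), (18, 15),
    (19, 16), (20, 17), (21, 19), (24, 22), (26, 24), (28, 1), (30, 27), (31, 28), (36, 34),
    (37, 35)]), (8, [3, 1, 0], [(8, 6), (18, 14), (29, 1), (37, 34)]), (9, [2, 2, 0], [(27, 24),
    (30, 26)]), (11, [3, 2, 0], [(0, 35), (19, 14), (20, 15), (28, 24), (30, 1)]), (12, [4, 2,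
    0], [(0, 34), (8, 5), (12, 9), (20, 14), (21, 16), (26, 22), (28, 23), (29, 24), (30, 25),
    (31, 1)]), (13, [0, 1, 1], [(22, 16), (37, 30)]), (14, [0, 2, 1], [(0, 31), (1, 20), (5, 2),
    (14, 13), (22, 15), (23, 17), (24, 18), (25, 19), (27, 21), (32, 24), (33, 25), (35, 26),
    (36, 28), (37, 29)]), (17, [1, 2, 1], [(0, 30), (9, 6), (10, 7), (22, 14), (23, 16),
    (24, 17), (28, 21), (32, 23), (36, 27), (37, 28)]), (20, [2, 2, 1], [(24, 16), (26, 19),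
    (29, 21), (37, 27)]), (23, [1, 3, 1], [(1, 18), (23, 15), (25, 17), (33, 23)]), (28, [3, 3,
    1], [(0, 27), (1, 16), (10, 5), (18, 13), (24, 14), (26, 17), (28, 19), (29, 20), (35, 23),
    (36, 25), (37, 1)]), (31, [4, 3, 1], [(37, 25)]), (36, [3, 4, 1], [(0, 26), (9, 4), (19, 13),
    (28, 18), (30, 20), (36, 24)])]
  cases :=
    .split [12, 22] 36 (.split [138, 50, 133, 10] 5 (.split [49, 2, 35] 28 (.split [127, 130,
    136, 101, 5, 108] 23 (.leaf []) (.leaf [51, 54, 16]) (.leaf [120, 110, 119, 94, 99, 96, 33,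
    95, 98, 32, 34])) (.leaf [122, 131, 61, 65, 19, 21, 127, 60, 27, 100, 108, 41, 56, 39, 25,
    26, 3, 95, 92, 124, 42]) (.split [127] 35 (.leaf []) (.leaf [21, 75, 15, 108, 103, 76, 41,
    18, 111, 62]) (.leaf [129, 51, 63, 65, 16, 23, 126, 41, 100, 89, 111, 103, 18, 91, 62, 28,
    30]))) (.leaf [52, 46, 36, 59, 108, 14, 5, 103, 111, 70, 60, 23, 27, 79, 62, 47, 125, 75, 76,
    28, 72, 31, 65, 100, 106, 44, 82, 83]) (.split [52, 15, 61, 51, 45, 44] 24 (.leaf []) (.leaf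
    [60, 47, 101, 127, 130, 5, 94, 96, 41]) (.leaf [108, 111, 103, 5, 47, 83, 48, 62, 70, 75, 71,
    72, 79, 125, 82, 129, 106, 100]))) (.leaf []) (.split [138] 28 (.split [5, 111, 127, 121, 46,
    18, 135, 41, 47, 2, 35, 48, 52] 14 (.split [91, 89, 125, 39, 92, 17] 2 (.leaf []) (.leaf [27,
    114, 13, 58, 56, 113, 87, 43, 80, 81, 82, 42, 93, 118, 55, 44, 117]) (.leaf [26, 31, 116, 42,
    23, 88, 25, 30, 80, 87, 86, 82, 93, 118, 44, 117, 51, 55])) (.leaf [90, 92, 3, 57, 62, 137])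
    (.leaf [73, 15, 54])) (.split [131, 127, 122, 19, 61] 37 (.leaf [35, 11, 36, 21, 52, 65, 49])
    (.leaf []) (.split [31] 5 (.split [52, 2] 14 (.leaf [89, 91, 39, 56, 24, 96, 132, 86, 7, 30,
    137, 80, 85]) (.leaf [125, 92, 16, 108, 57, 113, 3, 88, 135, 26, 8, 107, 7, 30, 132, 24, 45])
    (.leaf [54, 41, 73, 75, 108])) (.leaf [37, 46, 123, 48, 36, 14, 47, 108, 111, 70, 134, 1,
    105, 62, 71, 60]) (.split [52, 49] 14 (.split [92, 54, 40, 89, 41, 58, 96, 56, 7] 18 (.leaf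
    [95, 55, 17]) (.leaf [124, 88, 20, 43, 80, 81, 26, 86, 24, 132]) (.leaf [42, 26, 24, 80, 132,
    30, 86, 85])) (.leaf [16, 92, 125, 108, 59, 40, 41, 58, 7, 56, 107, 118, 93, 87, 3, 43, 20,
    137]) (.leaf [39, 56, 73, 41, 108, 75, 21, 72])))) (.split [136, 101, 130, 127] 17 (.split
    [108, 36, 17] 23 (.leaf [94, 110, 98, 119, 33, 120, 99, 95, 96, 34, 32]) (.leaf [117, 16, 6,
    51, 54, 53, 52, 67, 41, 68, 128, 42, 91, 26, 29]) (.leaf [118, 40, 4, 47, 52, 60, 54, 95,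
    55])) (.leaf []) (.split [109, 111, 112, 126] 37 (.leaf [35, 11, 21, 17, 36, 40, 52, 49, 4,
    60, 65]) (.split [23, 4] 5 (.split [2, 52] 20 (.leaf [114, 8, 42, 43, 58, 117, 63, 64, 86,
    53, 132, 45, 83, 78, 77, 69]) (.split [90, 116, 89, 97, 115, 39, 91, 20] 2 (.leaf []) (.leaf
    [26, 96, 24]) (.leaf [25, 81, 29, 6, 113, 84, 83, 117, 45, 132, 63, 58, 30, 7])) (.leaf [57,
    15, 128, 74, 17, 55, 6, 95, 102])) (.leaf [52, 14, 46, 36, 60, 38, 64, 53, 70, 79, 104, 66,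
    78, 69, 77]) (.leaf [52, 49, 40, 17, 60, 55, 6, 65, 95, 90, 102, 93, 128, 114, 9, 56, 113,
    87, 92, 3])) (.leaf []))))

/-- Certificate for `n = a ^ 3` and `b + 2 ≤ a < 2 b`, in the variables `s = a - b - 1 ≥ 1` and
`w = 2 b - a - 1 ≥ 0`, with monomials ordered as `1`, `s`, `s ^ 2`, `s ^ 3`, `w`, `s w`, `s ^ 2 w`,
`w ^ 2`, `s w ^ 2`, `w ^ 3`. -/
def Certificate.smallRatio : Certificate where
  size := [27, 54, 36, 8, 27, 36, 12, 9, 6, 1]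
  lower := [1, 1, 1, 1, 0, 0, 0, 0, 0, 0]
  mulA := [
    [3, 2, 0, 0, 1, 0, 0, 0, 0, 0], [0, 3, 2, 0, 0, 1, 0, 0, 0, 0],
    [0, 0, 3, 2, 0, 0, 1, 0, 0, 0], [0, 0, 0, 0, 3, 2, 0, 1, 0, 0],
    [0, 0, 0, 0, 0, 3, 2, 0, 1, 0], [0, 0, 0, 0, 0, 0, 0, 3, 2, 1]]
  mulB := [
    [2, 1, 0, 0, 1, 0, 0, 0, 0, 0], [0, 2, 1, 0, 0, 1, 0, 0, 0, 0],
    [0, 0, 2, 1, 0, 0, 1, 0, 0, 0], [0, 0, 0, 0, 2, 1, 0, 1, 0, 0],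
    [0, 0, 0, 0, 0, 2, 1, 0, 1, 0], [0, 0, 0, 0, 0, 0, 0, 2, 1, 1]]
  points := [
    [27, 54, 36, 8, 27, 36, 12, 9, 6, 1], [9, 21, 16, 4, 6, 10, 4, 1, 1, 0],
    [1, 3, 3, 1, 0, 0, 0, 0, 0, 0], [3, 5, 2, 0, 1, 1, 0, 0, 0, 0],
    [0, 2, 3, 1, 0, 1, 1, 0, 0, 0], [0, 3, 5, 2, 0, 1, 1, 0, 0, 0],
    [1, 5, 6, 2, 0, 1, 1, 0, 0, 0], [2, 5, 4, 1, 1, 2, 1, 0, 0, 0],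
    [3, 8, 7, 2, 1, 2, 1, 0, 0, 0], [5, 11, 8, 2, 2, 3, 1, 0, 0, 0],
    [4, 10, 8, 2, 2, 4, 2, 0, 0, 0], [5, 13, 11, 3, 2, 4, 2, 0, 0, 0],
    [6, 16, 14, 4, 2, 4, 2, 0, 0, 0], [7, 18, 15, 4, 3, 6, 3, 0, 0, 0],
    [9, 12, 4, 0, 6, 4, 0, 1, 0, 0], [1, 9, 10, 3, 0, 5, 3, 0, 1, 0],
    [0, 9, 12, 4, 0, 6, 4, 0, 1, 0], [3, 14, 14, 4, 1, 7, 4, 0, 1, 0],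
    [3, 5, 2, 0, 4, 6, 2, 1, 1, 0], [4, 8, 5, 1, 4, 6, 2, 1, 1, 0],
    [5, 11, 8, 2, 4, 6, 2, 1, 1, 0], [5, 13, 11, 3, 4, 7, 3, 1, 1, 0],
    [6, 13, 9, 2, 5, 8, 3, 1, 1, 0], [7, 16, 12, 3, 5, 8, 3, 1, 1, 0],
    [9, 18, 11, 2, 6, 9, 3, 1, 1, 0], [9, 19, 13, 3, 6, 9, 3, 1, 1, 0],
    [6, 15, 12, 3, 5, 9, 4, 1, 1, 0], [6, 16, 14, 4, 5, 9, 4, 1, 1, 0],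
    [7, 18, 15, 4, 5, 9, 4, 1, 1, 0], [8, 18, 13, 3, 6, 10, 4, 1, 1, 0],
    [10, 23, 17, 4, 7, 12, 5, 1, 1, 0], [11, 26, 20, 5, 7, 12, 5, 1, 1, 0],
    [12, 29, 23, 6, 7, 12, 5, 1, 1, 0], [13, 29, 21, 5, 8, 13, 5, 1, 1, 0],
    [7, 22, 19, 5, 5, 13, 6, 1, 2, 0], [9, 27, 23, 6, 6, 15, 7, 1, 2, 0],
    [10, 21, 14, 3, 9, 14, 5, 2, 2, 0], [11, 24, 17, 4, 9, 14, 5, 2, 2, 0],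
    [12, 26, 18, 4, 10, 16, 6, 2, 2, 0], [13, 29, 21, 5, 10, 16, 6, 2, 2, 0],
    [15, 32, 22, 5, 11, 17, 6, 2, 2, 0], [14, 31, 22, 5, 11, 18, 7, 2, 2, 0],
    [15, 34, 25, 6, 11, 18, 7, 2, 2, 0], [17, 39, 29, 7, 12, 20, 8, 2, 2, 0],
    [18, 42, 32, 8, 12, 20, 8, 2, 2, 0], [19, 42, 30, 7, 13, 21, 8, 2, 2, 0],
    [19, 42, 30, 7, 15, 24, 9, 3, 3, 0], [21, 45, 31, 7, 16, 25, 9, 3, 3, 0],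
    [21, 47, 34, 8, 16, 26, 10, 3, 3, 0], [9, 12, 4, 0, 15, 16, 4, 7, 4, 1],
    [12, 20, 11, 2, 16, 18, 5, 7, 4, 1], [13, 23, 14, 3, 16, 18, 5, 7, 4, 1],
    [13, 25, 17, 4, 16, 19, 6, 7, 4, 1], [14, 25, 15, 3, 17, 20, 6, 7, 4, 1],
    [15, 28, 18, 4, 17, 20, 6, 7, 4, 1], [17, 33, 22, 5, 18, 22, 7, 7, 4, 1],
    [15, 25, 13, 2, 20, 24, 7, 8, 5, 1], [17, 31, 19, 4, 20, 24, 7, 8, 5, 1],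
    [18, 33, 20, 4, 21, 26, 8, 8, 5, 1], [19, 36, 23, 5, 21, 26, 8, 8, 5, 1],
    [21, 38, 22, 4, 22, 27, 8, 8, 5, 1], [18, 35, 23, 5, 21, 27, 9, 8, 5, 1],
    [19, 38, 26, 6, 21, 27, 9, 8, 5, 1], [20, 38, 24, 5, 22, 28, 9, 8, 5, 1],
    [21, 41, 27, 6, 22, 28, 9, 8, 5, 1], [23, 44, 28, 6, 23, 29, 9, 8, 5, 1],
    [23, 46, 31, 7, 23, 30, 10, 8, 5, 1], [24, 49, 34, 8, 23, 30, 10, 8, 5, 1],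
    [19, 42, 30, 7, 21, 31, 11, 8, 6, 1], [21, 47, 34, 8, 22, 33, 12, 8, 6, 1],
    [21, 38, 22, 4, 25, 32, 10, 9, 6, 1], [23, 46, 31, 7, 25, 33, 11, 9, 6, 1],
    [24, 46, 29, 6, 26, 34, 11, 9, 6, 1], [25, 49, 32, 7, 26, 34, 11, 9, 6, 1],
    [24, 48, 32, 7, 26, 35, 12, 9, 6, 1], [25, 51, 35, 8, 26, 35, 12, 9, 6, 1],
    [26, 51, 33, 7, 27, 36, 12, 9, 6, 1]]
  solutions := [
    (0, [9, 12, 4, 6, 4, 1], [(0, 1), (59, 2), (61, 4), (62, 6), (63, 7), (64, 8), (65, 9),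
    (66, 11), (68, 15), (71, 21), (72, 22), (73, 23), (74, 26), (75, 28), (76, 29)]), (1, [3, 5,
    2, 1, 1, 0], [(1, 8), (23, 2), (24, 3), (27, 5), (28, 6), (29, 7), (30, 10), (31, 11),
    (36, 19), (37, 20), (38, 22), (39, 23), (40, 25), (42, 1), (43, 31), (44, 32), (45, 33),
    (47, 40), (56, 49), (59, 51), (62, 52), (63, 53), (64, 54), (66, 55), (72, 58), (73, 59),
    (76, 63)]), (3, [1, 1, 0, 0, 0, 0], [(1, 28), (7, 4), (8, 6), (9, 8), (25, 23), (33, 31),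
    (40, 39), (45, 43), (47, 46), (54, 52), (64, 62), (65, 64), (73, 71), (76, 74)]), (5, [0, 1,
    1, 0, 0, 0], [(1, 25), (6, 2), (28, 23), (42, 40), (52, 51), (74, 72), (75, 73)]), (8, [1, 2,
    1, 0, 0, 0], [(0, 73), (8, 2), (11, 8), (22, 19), (23, 20), (28, 21), (29, 22), (35, 34),
    (39, 37), (41, 38), (42, 39), (43, 42), (48, 46), (53, 50), (55, 54), (63, 58), (64, 59),
    (66, 64), (69, 68), (76, 72)]), (12, [2, 4, 2, 0, 0, 0], [(11, 2), (31, 23), (33, 25),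
    (42, 37), (43, 39), (45, 40)]), (14, [3, 2, 0, 1, 0, 0], [(14, 3), (39, 34), (73, 68)]), (16,
    [0, 3, 2, 0, 1, 0], [(15, 2), (16, 5), (35, 1), (68, 59)]), (17, [1, 4, 2, 0, 1, 0],
    [(17, 6), (35, 28), (69, 62)]), (18, [1, 1, 0, 1, 1, 0], [(19, 7), (20, 8), (23, 11),
    (36, 29), (40, 33), (47, 45), (57, 54), (59, 55)]), (22, [2, 3, 1, 1, 1, 0], [(0, 66),
    (1, 11), (22, 7), (23, 8), (29, 10), (31, 13), (34, 17), (36, 22), (37, 23), (39, 1),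
    (41, 30), (42, 31), (46, 42), (57, 51), (59, 54), (64, 55), (73, 64)]), (24, [3, 4, 1, 1, 1,
    0], [(22, 4), (25, 8), (38, 26), (39, 28), (40, 1), (59, 52), (72, 61), (73, 62)]), (27, [2,
    4, 2, 1, 1, 0], [(1, 9), (21, 2), (28, 8), (39, 25), (46, 40), (71, 59), (75, 64)]), (32, [4,
    7, 3, 1, 1, 0], [(0, 59), (1, 2), (31, 8), (35, 15), (39, 20), (46, 37), (48, 39)]), (35, [3,
    7, 3, 1, 2, 0], [(68, 52)]), (38, [4, 6, 2, 2, 2, 0], [(38, 10), (39, 11), (42, 13),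
    (46, 31), (73, 55)]), (42, [5, 8, 3, 2, 2, 0], [(0, 55), (38, 7), (42, 11), (72, 53),
    (73, 54)]), (44, [6, 10, 4, 2, 2, 0], [(0, 54), (39, 2), (41, 7), (42, 8), (43, 11),
    (44, 12), (46, 23), (48, 1), (72, 50)]), (48, [7, 11, 4, 3, 3, 0], [(48, 13)]), (49, [3, 2,
    0, 4, 2, 1], [(0, 48), (49, 18), (50, 22), (51, 23), (54, 1), (55, 31), (57, 37), (58, 38),
    (59, 39), (64, 42), (66, 43), (73, 46)]), (50, [4, 4, 1, 4, 2, 1], [(51, 20), (54, 23),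
    (55, 1), (59, 37), (64, 39), (66, 42)]), (54, [5, 6, 2, 4, 2, 1], [(54, 20), (55, 23),
    (66, 39)]), (56, [5, 5, 1, 5, 3, 1], [(0, 43), (51, 8), (54, 11), (59, 1), (64, 31),
    (68, 35), (73, 42)]), (58, [6, 7, 2, 5, 3, 1], [(0, 42), (51, 2), (52, 6), (54, 8), (55, 11),
    (57, 20), (58, 22), (59, 23), (61, 26), (62, 28), (63, 29), (64, 1), (66, 31), (67, 32),
    (68, 34), (69, 35), (73, 39)]), (60, [7, 8, 2, 5, 3, 1], [(59, 21), (64, 28), (65, 1)]), (64,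
    [7, 9, 3, 5, 3, 1], [(0, 39), (54, 2), (55, 8), (58, 19), (59, 20), (63, 22), (64, 23),
    (66, 1), (69, 34), (72, 36), (73, 37)]), (67, [8, 11, 4, 5, 3, 1], [(55, 2), (64, 20),
    (66, 23)]), (69, [7, 11, 4, 5, 4, 1], [(69, 28)]), (70, [7, 8, 2, 6, 4, 1], [(58, 10),
    (59, 11), (72, 30)]), (72, [8, 10, 3, 6, 4, 1], [(0, 31), (57, 2), (58, 7), (59, 8),
    (64, 11), (68, 17), (71, 28), (72, 29), (73, 1)])]
  cases :=
    .split [15, 28] 8 (.split [64, 63, 5, 65] 22 (.split [69, 201, 107, 110, 66, 10, 114, 109] 72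
    (.leaf []) (.split [39, 241, 240, 211] 39 (.leaf [71, 73, 154, 237, 156, 221, 218, 176, 23,
    225, 24, 101, 102, 100, 200, 168, 171, 173, 105]) (.leaf [26, 221, 202, 224, 183, 102, 222,
    37, 237, 154, 207, 199, 74, 152, 118, 29, 177, 172, 169, 168, 106, 180, 121]) (.leaf []))
    (.split [240, 20, 235, 206, 237, 224, 199, 221, 22, 202, 102, 23, 16, 234, 216, 99, 168, 100]
    59 (.leaf [106, 121, 171, 176, 172, 118]) (.leaf []) (.leaf [219, 200, 185, 105]))) (.leaf
    [25, 116, 109, 108, 201, 154, 195, 160, 73, 199, 148, 152, 74, 122, 149, 153, 235, 181, 38,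
    183, 211, 241, 233, 236, 40, 184, 207, 172, 112, 175, 29, 166, 167, 161, 164]) (.split [109,
    201] 64 (.leaf []) (.leaf [206, 198, 195, 118, 222, 221, 37, 154, 22, 156, 121, 207, 40, 187,
    184, 202, 115, 225, 182, 183, 71]) (.split [220, 221, 122, 123, 40, 241] 42 (.leaf [73, 152,
    160, 151, 181, 195, 199, 211, 237, 148, 72, 240, 236, 147, 153, 183, 121, 20, 231, 219, 111,
    21, 230, 232, 117, 159, 158, 16, 180, 185, 67]) (.leaf []) (.split [119, 176, 154, 118, 22,
    141, 233, 155] 55 (.leaf [77, 172, 178, 171, 185, 216, 75, 16, 140, 67, 84, 24, 163, 83, 162,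
    86, 71, 158, 145, 164]) (.leaf [38, 199, 207, 78, 181, 36, 184, 76]) (.leaf []))))) (.leaf
    []) (.split [64, 65] 42 (.split [195, 152, 154, 22, 108] 58 (.leaf []) (.split [199, 206, 39,
    77, 217, 221, 176, 215] 23 (.leaf []) (.leaf [26, 16, 202, 216, 171, 175, 1]) (.leaf [67,
    110, 118, 172, 10, 236, 171, 84, 121, 216, 83, 185, 175, 71, 86, 24])) (.leaf [198, 201, 118,
    107, 207, 38, 172, 222, 217, 215, 176, 221, 123, 171, 216, 16, 202, 121, 40, 175, 211]))
    (.leaf []) (.split [160, 74, 73] 23 (.split [221, 11] 64 (.leaf []) (.split [222, 37, 206] 22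
    (.leaf [10, 201, 107, 184, 198, 180, 157, 121, 165, 236, 40, 194, 191, 188, 161, 190]) (.leaf
    [123, 116, 156, 122, 25, 108, 186, 148, 151]) (.split [109, 69, 201, 202] 72 (.leaf [240,
    235, 20]) (.leaf [237, 241, 7, 156, 157, 180, 184, 165]) (.leaf [236, 191, 40, 156, 194, 157,
    188, 190, 161]))) (.split [176, 217, 79, 80] 55 (.split [186] 59 (.split [139, 202, 1, 106,
    140, 141] 31 (.split [172, 168, 171, 105, 156, 233, 84, 241, 198, 196, 174, 201, 178, 82,
    211, 240, 33] 22 (.leaf [107, 115, 177, 188, 189, 120, 173, 86, 162, 161, 83]) (.leaf [])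
    (.split [119, 109, 163, 220, 162, 150] 7 (.leaf [4, 205, 14, 41]) (.split [20, 14] 43 (.split
    [188, 189] 3 (.split [50, 46, 49, 47, 48] 25 (.leaf []) (.leaf [27, 88, 31, 103]) (.leaf [85,
    31, 104, 32, 88])) (.split [43, 17, 55, 54, 42] 28 (.leaf [58, 127, 130, 13, 125, 126, 124,
    2, 203, 12, 61, 56, 62, 135, 138, 18]) (.leaf []) (.leaf [134, 239, 68, 137, 9, 133]))
    (.split [89, 45, 52, 53, 44, 51] 5 (.leaf [60, 197, 35, 3]) (.leaf [62, 56, 57, 18, 3, 131,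
    204, 35, 129, 125, 135, 138, 13, 134]) (.split [59, 93] 52 (.split [129] 28 (.split [229] 68
    (.leaf [8, 146, 95, 94, 142, 92]) (.leaf [209, 91, 90, 70, 223, 113, 210, 97, 96, 98, 3])
    (.leaf [81, 238, 210, 193, 97, 96, 98, 3])) (.leaf [204, 19, 3]) (.split [68, 213, 134] 40
    (.leaf [136, 133, 212, 132, 214, 6]) (.leaf [27, 128, 125, 135, 132, 133, 212, 6, 214])
    (.leaf []))) (.leaf [197, 35, 3]) (.leaf [])))) (.leaf [177, 161, 7]) (.leaf [])) (.leaf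
    []))) (.leaf [22, 29, 7, 207, 161, 198, 171, 158, 175]) (.leaf [])) (.leaf [40, 191, 225,
    123, 34, 194, 156, 171, 185, 188, 121, 172, 169, 170, 115, 29, 141, 107, 182, 187, 179, 143,
    140, 158, 30]) (.leaf [])) (.leaf [38, 107, 7, 108, 199, 22, 201, 118, 207]) (.leaf [])))
    (.split [26, 221, 215, 79, 16, 1, 80, 158, 217, 30, 164, 163, 202, 40, 162] 22 (.leaf [107,
    228, 38, 201, 226, 227, 208, 145, 143, 75, 144, 24, 86, 83, 87, 161]) (.leaf [115, 108, 7,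
    83, 38, 86, 228, 199, 226, 208, 145, 144, 75]) (.leaf [201, 211, 123])) (.split [221, 110,
    67] 22 (.split [10, 201] 64 (.split [215, 123] 59 (.leaf [219, 121, 185, 156, 211, 198])
    (.leaf [40, 191, 194, 192, 188, 87, 29, 84, 162, 161, 158, 83]) (.leaf [202, 39, 236]))
    (.leaf [206, 202, 37, 198, 185, 219, 121]) (.leaf [])) (.leaf [109, 201, 108, 25, 116, 215,
    220, 122, 123, 148, 153, 4, 78, 211, 151, 199]) (.leaf []))))

theorem Certificate.schur_valid : Certificate.schur.valid = true := by decide +kernel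

theorem Certificate.pred_valid : Certificate.pred.valid = true := by decide +kernel

theorem Certificate.largeRatio_valid : Certificate.largeRatio.valid = true := by decide +kernel

theorem Certificate.smallRatio_valid : Certificate.smallRatio.valid = true := by decide +kernel

/-! ### The Rado numbers -/

open CoeffList

/-- For `m = 3` this is the Schur number, in general a Rado number of Schur type. -/
theorem radoNumber_schur {m : ℕ} (hm : 3 ≤ m) :
    radoNumber 3 (fun x y z => x - y = ((m : ℤ) - 2) * z) =
      ((m ^ 3 - m ^ 2 - m - 1 : ℕ) : ℕ∞) := by
  obtain ⟨u, rfl⟩ := Nat.exists_eq_add_of_le hm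
  have hn : (3 + u) ^ 3 - (3 + u) ^ 2 - (3 + u) - 1 = u ^ 3 + 8 * u ^ 2 + 20 * u + 14 := by
    have : (3 + u) ^ 3 = u ^ 3 + 8 * u ^ 2 + 20 * u + 14 + (1 + (3 + u) + (3 + u) ^ 2) := by ring
    lia
  rw [hn]
  refine radoNumber_eq ?_ ?_
  · have h := Certificate.forces Certificate.schur_valid (a := 1) (b := 1 + u)
      (n := u ^ 3 + 8 * u ^ 2 + 20 * u + 14) [1, u, u ^ 2, u ^ 3] [1, u, u ^ 2]
      (by simp [Certificate.schur]) (by simp [Certificate.schur, eval])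
      (by simp [Certificate.schur, eval]; ring_nf; simp) (by simp [Certificate.schur, eval]; ring)
    convert h using 4 with x y z
    push_cast
    ring_nf
  · obtain ⟨χ, hχ⟩ := exists_block_coloring (q := u + 1) (by lia)
    refine ⟨χ, fun x y z hx _ _ _ hy hz hE => ?_⟩
    obtain rfl : x = y + (u + 1) * z := by
      zify
      push_cast at hE
      linarith
    refine hχ y z hy hz ?_
    have : (u + 1) ^ 3 + 5 * (u + 1) ^ 2 + 7 * (u + 1) + 1 = u ^ 3 + 8 * u ^ 2 + 20 * u + 14 := by
      ring
    lia

theorem radoNumber_pred {a : ℕ} (ha : 3 ≤ a) :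
    radoNumber 3 (fun x y z => (a : ℤ) * (x - y) = ((a : ℤ) - 1) * z) =
      ((a ^ 3 + (a - 1) ^ 2 : ℕ) : ℕ∞) := by
  have hcast : ((a : ℤ) - 1) = ((a - 1 : ℕ) : ℤ) := by
    rw [Nat.cast_sub (by lia), Nat.cast_one]
  rw [hcast]
  refine radoNumber_eq ?_ (exists_pred_coloring ha)
  obtain ⟨u, rfl⟩ := Nat.exists_eq_add_of_le ha
  rw [show 3 + u - 1 = 2 + u by lia]
  refine Certificate.forces Certificate.pred_valid [1, u, u ^ 2, u ^ 3] [1, u, u ^ 2]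
    (by simp [Certificate.pred]) ?_ ?_ ?_
  · simp [Certificate.pred, eval]; ring_nf; simp
  · simp [Certificate.pred, eval]; ring_nf; simp
  · simp [Certificate.pred, eval]; ring

theorem forces_of_two_mul_lt {a b : ℕ} (hb : 1 ≤ b) (h : 2 * b < a) :
    ForcesMonochromaticSolution 3 (fun x y z => (a : ℤ) * (x - y) = (b : ℤ) * z) (a ^ 3) := by
  obtain ⟨d, rfl⟩ := Nat.exists_eq_add_of_le h.le
  have hd : 1 ≤ d := by lia
  refine Certificate.forces Certificate.largeRatio_valid [b ^ 3, b ^ 2 * d, b * d ^ 2, d ^ 3]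
    [b ^ 2, b * d, d ^ 2] ?_ ?_ ?_ ?_
  · simp [Certificate.largeRatio]
    refine ⟨?_, ?_, ?_, ?_⟩ <;> apply Nat.pos_of_ne_zero <;> positivity
  · simp [Certificate.largeRatio, eval]; ring_nf; simp
  · simp [Certificate.largeRatio, eval]; ring_nf; simp
  · simp [Certificate.largeRatio, eval]; ring

theorem forces_of_lt_two_mul {a b : ℕ} (hb : b + 2 ≤ a) (h : a < 2 * b) :
    ForcesMonochromaticSolution 3 (fun x y z => (a : ℤ) * (x - y) = (b : ℤ) * z) (a ^ 3) := by
  obtain ⟨s, w, hs, rfl, rfl⟩ : ∃ s w, 1 ≤ s ∧ a = 3 + 2 * s + w ∧ b = 2 + s + w :=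
    ⟨a - b - 1, 2 * b - a - 1, by lia, by lia, by lia⟩
  refine Certificate.forces Certificate.smallRatio_valid
    [1, s, s ^ 2, s ^ 3, w, s * w, s ^ 2 * w, w ^ 2, s * w ^ 2, w ^ 3]
    [1, s, s ^ 2, w, s * w, w ^ 2] ?_ ?_ ?_ ?_
  · simp [Certificate.smallRatio, Nat.one_le_pow _ _ hs, hs]
  · simp [Certificate.smallRatio, eval]; ring_nf; simp
  · simp [Certificate.smallRatio, eval]; ring_nf; simp
  · simp [Certificate.smallRatio, eval]; ring

theorem radoNumber_coprime {a b : ℕ} (hb : 1 ≤ b) (hba : b + 2 ≤ a) (hab : a.Coprime b) :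
    radoNumber 3 (fun x y z => (a : ℤ) * (x - y) = (b : ℤ) * z) = ((a ^ 3 : ℕ) : ℕ∞) := by
  refine radoNumber_eq ?_ (exists_valuation_coloring (by lia) hab)
  rcases lt_trichotomy (2 * b) a with h | h | h
  · exact forces_of_two_mul_lt hb h
  · have : b = 1 := (hab.symm.coprime_dvd_right (Dvd.intro_left 2 h)).eq_one_of_dvd dvd_rfl
    lia
  · exact forces_of_lt_two_mul hba h

/-- The subtractions on the right-hand sides are between natural numbers; in the stated ranges of
the parameters none of them truncates. -/
theorem theorem1p2 :
    (∀ m : ℕ, 3 ≤ m →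
      radoNumber 3 (fun x y z => x - y = ((m : ℤ) - 2) * z)
        = ((m ^ 3 - m ^ 2 - m - 1 : ℕ) : ℕ∞)) ∧
    (∀ a : ℕ, 3 ≤ a →
      radoNumber 3 (fun x y z => (a : ℤ) * (x - y) = ((a : ℤ) - 1) * z)
        = ((a ^ 3 + (a - 1) ^ 2 : ℕ) : ℕ∞)) ∧
    (∀ a b : ℕ, 1 ≤ b → b + 2 ≤ a → Nat.gcd a b = 1 →
      radoNumber 3 (fun x y z => (a : ℤ) * (x - y) = (b : ℤ) * z)
        = ((a ^ 3 : ℕ) : ℕ∞)) := by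
  exact ⟨fun _ => radoNumber_schur, fun _ => radoNumber_pred,
    fun _ _ => radoNumber_coprime⟩
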